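/- Let $d\ge 2$. A square real matrix $A=(a_{ij})$ of order $d+1$ is *normal idempotent* if $a_{ii}=0$, $a_{ij}\le 0$ and $\max_j (a_{ij}+a_{jk})=a_{ik}$ for all $i,k$. Let $\mathcal P\subset\mathbb R^d$ be a $d$-dimensional isocanted alcoved polytope ($d$-IAP); that is, $$\mathcal P=\{x\in\mathbb R^d:\ a_{i,d+1}\le x_i\le -a_{d+1,i},\ \ a_{ij}\le x_i-x_j\le -a_{ji}\ \ (1\le i,j\le d)\}$$ for a normal idempotent matrix $A=B-E$, where, for some real numbers $t_1,\dots,t_d$, $t_{d+1}=0$, $\ell_1,\dots,\ell_d>0$ and $a$ with $0<a<\min_i\ell_i$: the matrix $B=(b_{ij})$ is normal idempotent with $b_{ij}=t_i-\ell_i-t_j$ if $d+1\ne i\ne j$ and $b_{ij}=t_i-t_j$ otherwise, and $E=(e_{ij})$ has $e_{ij}=-a$ if $i,j\le d$, $i\neq j$, and $e_{ij}=0$ otherwise. Then $\mathcal P$ is $d$-elementary, which means the following. Let $\mathcal Q$ be any $(d+1)$-cuboid (a polytope whose face lattice is isomorphic to that of the cube $[0,1]^{d+1}$), let $V$ be any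 vertex of $\mathcal Q$, let the cask $\mathcal F_V$ be the complex formed by the facets of $\mathcal Q$ that contain $V$ and all their faces, and let $\mathcal C_V$ be its outer boundary, i.e. the subcomplex of $\mathcal F_V$ generated by the $(d-1)$-dimensional faces that lie in exactly one facet belonging to $\mathcal F_V$. Then $\mathcal P$ is a polytope and its boundary complex $\partial\mathcal P$ (all proper faces of $\mathcal P$) is combinatorially equivalent to $\mathcal C_V$: there is an inclusion-preserving bijection between their faces, with inclusion-preserving inverse. -/

import Mathlib

/-! ### Polytopes, faces, polyhedral complexes -/

/-- A polyhedron: the intersection of finitely many closed halfspaces of `ℝⁿ`. -/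
def IsPolyhedron {n : ℕ} (P : Set (Fin n → ℝ)) : Prop :=
  ∃ (m : ℕ) (c : Fin m → ((Fin n → ℝ) →ₗ[ℝ] ℝ)) (b : Fin m → ℝ),
    P = {x | ∀ k, c k x ≤ b k}

/-- A polytope: a bounded polyhedron. -/
def IsPolytope {n : ℕ} (P : Set (Fin n → ℝ)) : Prop :=
  IsPolyhedron P ∧ Bornology.IsBounded P

/-- All faces of `P`: the empty face and the sets where some linear functional attains its
maximum over `P` (the zero functional gives `P` itself). Ordered by inclusion, this is the
face lattice. -/
def faces {n : ℕ} (P : Set (Fin n → ℝ)) : Set (Set (Fin n → ℝ)) :=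
  {F | IsExposed ℝ P F}

/-- The boundary complex `∂P`: all faces of `P` other than `P`. -/
def boundaryComplex {n : ℕ} (P : Set (Fin n → ℝ)) : Set (Set (Fin n → ℝ)) :=
  {F | F ∈ faces P ∧ F ≠ P}

/-- The facets of `P`: its maximal proper faces. -/
def facets {n : ℕ} (P : Set (Fin n → ℝ)) : Set (Set (Fin n → ℝ)) :=
  {F | Maximal (fun G => G ∈ boundaryComplex P) F}

/-- `V` is a vertex of `P`. -/
def IsVertex {n : ℕ} (P : Set (Fin n → ℝ)) (V : Fin n → ℝ) : Prop :=
  ({V} : Set (Fin n → ℝ)) ∈ faces P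

/-- Combinatorial equivalence of two families of cells (face lattices or complexes):
an inclusion-preserving bijection whose inverse preserves inclusion. -/
def CombEquiv {n m : ℕ} (K : Set (Set (Fin n → ℝ))) (L : Set (Set (Fin m → ℝ))) : Prop :=
  Nonempty (K ≃o L)

/-- `R` is a free ridge of the complex `K`: it is covered by a maximal cell `F` of `K`
(that is, it has codimension one in `F`), and `F` is the only maximal cell of `K`
that contains `R`. -/
def IsFreeRidge {n : ℕ} (K : Set (Set (Fin n → ℝ))) (R : Set (Fin n → ℝ)) : Prop :=
  R ∈ K ∧ ∃ F, Maximal (fun G => G ∈ K) F ∧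
    R ⊂ F ∧ (∀ G ∈ K, ¬ (R ⊂ G ∧ G ⊂ F)) ∧
    ∀ F', Maximal (fun G => G ∈ K) F' → R ⊆ F' → F' = F

/-- The (outer) boundary of a pure complex `K`: the subcomplex generated by the ridges that
lie in exactly one maximal cell. -/
def outerComplex {n : ℕ} (K : Set (Set (Fin n → ℝ))) : Set (Set (Fin n → ℝ)) :=
  {G | G ∈ K ∧ ∃ R, IsFreeRidge K R ∧ G ⊆ R}

/-! ### Cuboids, casks, elementary polytopes -/

/-- The standard `k`-cube `[0,1]ᵏ`. -/
def stdCube (k : ℕ) : Set (Fin k → ℝ) := Set.Icc 0 1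

/-- A `k`-cuboid: a polytope combinatorially equivalent to the `k`-cube. -/
def IsCuboid {n : ℕ} (k : ℕ) (Q : Set (Fin n → ℝ)) : Prop :=
  IsPolytope Q ∧ CombEquiv (faces Q) (faces (stdCube k))

/-- The cask of `Q` at `V`: the complex formed by the facets of `Q` that contain `V`,
together with all their faces. -/
def cask {n : ℕ} (Q : Set (Fin n → ℝ)) (V : Fin n → ℝ) : Set (Set (Fin n → ℝ)) :=
  {G | G ∈ faces Q ∧ ∃ F ∈ facets Q, V ∈ F ∧ G ⊆ F}

/-- `P` is `d`-elementary: it is a polytope, and for every `(d+1)`-cuboid `Q` and every vertex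
`V` of `Q`, its boundary complex is combinatorially equivalent to the complex of outer faces
of the cask of `Q` at `V`. -/
def IsElementary {n : ℕ} (d : ℕ) (P : Set (Fin n → ℝ)) : Prop :=
  IsPolytope P ∧ ∀ (m : ℕ) (Q : Set (Fin m → ℝ)) (V : Fin m → ℝ),
    IsCuboid (d + 1) Q → IsVertex Q V →
      CombEquiv (boundaryComplex P) (outerComplex (cask Q V))

/-! ### Isocanted alcoved polytopes

Matrices of order `d+1` are indexed by `Fin (d+1)`; the index `d+1` is `Fin.last d`, and an
index `i ≤ d` is `Fin.castSucc i`. -/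

/-- The alcoved polytope given by the matrix `A`. -/
def alcoved {d : ℕ} (A : Matrix (Fin (d + 1)) (Fin (d + 1)) ℝ) : Set (Fin d → ℝ) :=
  {x | (∀ i : Fin d, A i.castSucc (Fin.last d) ≤ x i ∧ x i ≤ -A (Fin.last d) i.castSucc) ∧
    ∀ i j : Fin d, A i.castSucc j.castSucc ≤ x i - x j ∧
      x i - x j ≤ -A j.castSucc i.castSucc}

/-- The max-plus product of two square matrices. -/
def tropMul {d : ℕ} (A B : Matrix (Fin (d + 1)) (Fin (d + 1)) ℝ) :
    Matrix (Fin (d + 1)) (Fin (d + 1)) ℝ :=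
  Matrix.of fun i k =>
    Finset.univ.sup' Finset.univ_nonempty fun j : Fin (d + 1) => A i j + B j k

/-- Normal idempotent matrices: zero diagonal, nonpositive entries, `A ⊙ A = A`. -/
def IsNI {d : ℕ} (A : Matrix (Fin (d + 1)) (Fin (d + 1)) ℝ) : Prop :=
  (∀ i, A i i = 0) ∧ (∀ i j, A i j ≤ 0) ∧ tropMul A A = A

/-- The visualized box matrix with edge lengths `ℓ`: the entry at `(i, j)` is `-ℓ i` if
`i ≠ d+1` and `i ≠ j`, and `0` otherwise. -/
def boxVNI {d : ℕ} (l : Fin d → ℝ) : Matrix (Fin (d + 1)) (Fin (d + 1)) ℝ :=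
  Matrix.of fun i j =>
    Fin.lastCases 0 (fun k : Fin d => if k.castSucc = j then 0 else -l k) i

/-- `B` is a box matrix with edge lengths `l`: a conjugate `D ⊙ boxVNI l ⊙ D⁻¹` by a max-plus
diagonal matrix `D = diag(t)` whose last diagonal entry is zero, where all `l i > 0`. -/
def IsBoxMatrix {d : ℕ} (l : Fin d → ℝ) (B : Matrix (Fin (d + 1)) (Fin (d + 1)) ℝ) : Prop :=
  (∀ i, 0 < l i) ∧ ∃ t : Fin (d + 1) → ℝ, t (Fin.last d) = 0 ∧
    ∀ i j, B i j = t i + boxVNI l i j - t j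

/-- Perturbation matrices: nonpositive, with null diagonal, last row and last column. -/
def IsPerturbation {d : ℕ} (E : Matrix (Fin (d + 1)) (Fin (d + 1)) ℝ) : Prop :=
  (∀ i, E i i = 0) ∧ (∀ j, E (Fin.last d) j = 0) ∧ (∀ i, E i (Fin.last d) = 0) ∧
    ∀ i j, E i j ≤ 0

/-- `P` is a `d`-dimensional isocanted alcoved polytope: `P` is the alcoved polytope of a normal
idempotent matrix `A = B - E`, with `B` a normal idempotent box matrix with edge lengths `l i`
and `E` the constant perturbation matrix with cant parameter `a`, where `0 < a < l i`
for all `i`. -/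
def IsIAP {d : ℕ} (P : Set (Fin d → ℝ)) : Prop :=
  ∃ (A B E : Matrix (Fin (d + 1)) (Fin (d + 1)) ℝ) (l : Fin d → ℝ) (a : ℝ),
    P = alcoved A ∧ IsNI A ∧ A = B - E ∧ IsNI B ∧ IsBoxMatrix l B ∧ IsPerturbation E ∧
    0 < a ∧ (∀ i, a < l i) ∧
    ∀ i j : Fin d, i ≠ j → E i.castSucc j.castSucc = -a

/-! Both complexes are identified with one poset: the sign vectors of length `d + 1` in which both
signs occur, together with a bottom element for the empty face.

On the side of the polytope, an isocanted alcoved polytope is a zonotope: up to translation it is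
the image of a box with edges `l i - a` and `a` under the projection along the diagonal
(`alcoved_eq_diagProj`). All edges are positive because `0 < a < l i`. A functional on the image
pulls back, up to a constant, to a functional on the box whose coefficients sum to zero, so its
maximal face is the image of a box face whose label is the sign pattern of those coefficients.
Nonzero zero-sum vectors realise exactly the mixed patterns, and distinct mixed labels have distinct
images (`mem_boundaryComplex_diagProj`, `diagProj_boxFace_subset_iff`).

On the side of the cuboid, faces carry sign vectors through the isomorphism with the cube, and `V`
has a label `v` without zeros. A face is in the cask when it agrees with `v` somewhere, and in the
outer boundary when it is moreover opposite to `v` somewhere (`mem_outerComplex_iff`). Multiplying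
labels by `v` turns this condition into mixedness. -/

/-! ### Sign vectors -/

/-- Sign vectors, labelling the nonempty faces of a `k`-dimensional box: the sign `1` stands for
the upper end of an edge, `-1` for the lower end, and `0` for the whole edge. -/
@[ext]
structure SignVec (k : ℕ) where
  /-- The signs. -/
  sign : Fin k → SignType

instance {k : ℕ} : CoeFun (SignVec k) fun _ => Fin k → SignType := ⟨SignVec.sign⟩

/-- This is inclusion of box faces: the smaller face fixes every coordinate that the larger one
fixes, at the same end. -/
instance {k : ℕ} : PartialOrder (SignVec k) where
  le σ τ := ∀ i, τ i ≠ 0 → σ i = τ i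
  le_refl _ _ _ := rfl
  le_trans σ τ ρ h₁ h₂ i hi := by
    have h := h₂ i hi
    rw [← h]
    exact h₁ i (by rwa [h])
  le_antisymm σ τ h₁ h₂ := by
    ext i : 2
    by_cases hi : τ i = 0
    · by_cases hj : σ i = 0
      · rw [hi, hj]
      · exact (h₂ i hj).symm
    · exact h₁ i hi

/-- A sign vector in which both signs occur. -/
def SignVec.Mixed {k : ℕ} (σ : SignVec k) : Prop := (∃ i, σ i = 1) ∧ ∃ j, σ j = -1

/-- The family consisting of the empty set and of sets `F i` with `F` an order embedding of `ι`
into the nonempty sets is order isomorphic to `ι` with a bottom element added. -/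
theorem nonempty_orderIso_withBot {ι α : Type*} [PartialOrder ι] (F : ι → Set α)
    (hne : ∀ i, (F i).Nonempty) (hle : ∀ i j, F i ⊆ F j ↔ i ≤ j) (K : Set (Set α))
    (hK : ∀ G, G ∈ K ↔ G = ∅ ∨ ∃ i, G = F i) : Nonempty (K ≃o WithBot ι) := by
  let f : WithBot ι → Set α := WithBot.recBotCoe ∅ F
  have hf : ∀ a b, f a ≤ f b ↔ a ≤ b := by
    intro a b
    induction a using WithBot.recBotCoe with
    | bot => simp [f]
    | coe i =>
      induction b using WithBot.recBotCoe with
      | bot => simpa [f, ← Set.nonempty_iff_ne_empty] using hne i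
      | coe j => simpa [f] using hle i j
  have hr : Set.range f = K := by
    ext G
    rw [hK]
    constructor
    · rintro ⟨a, rfl⟩
      induction a using WithBot.recBotCoe with
      | bot => exact Or.inl rfl
      | coe i => exact Or.inr ⟨i, rfl⟩
    · rintro (rfl | ⟨i, rfl⟩)
      · exact ⟨⊥, rfl⟩
      · exact ⟨(i : WithBot ι), rfl⟩
  subst hr
  exact ⟨(OrderEmbedding.orderIso (f := OrderEmbedding.ofMapLEIff f hf)).symm⟩

/-! ### Faces of boxes -/

/-- The face of the box `[0, m]` with label `σ`. -/
def boxFace {k : ℕ} (m : Fin k → ℝ) (σ : SignVec k) : Set (Fin k → ℝ) :=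
  {x | x ∈ Set.Icc 0 m ∧ ∀ i, (σ i = 1 → x i = m i) ∧ (σ i = -1 → x i = 0)}

/-- The centre of a face of a box. -/
noncomputable def boxCentre {k : ℕ} (m : Fin k → ℝ) (σ : SignVec k) : Fin k → ℝ :=
  fun i => (1 + ((σ i : SignType) : ℝ)) / 2 * m i

theorem boxCentre_mem {k : ℕ} {m : Fin k → ℝ} (hm : ∀ i, 0 < m i) (σ : SignVec k) :
    boxCentre m σ ∈ boxFace m σ := by
  refine ⟨⟨fun i => ?_, fun i => ?_⟩, fun i => ⟨fun h => ?_, fun h => ?_⟩⟩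
  · have := hm i
    rcases (σ i).trichotomy with h | h | h <;> simp [boxCentre, h] <;> linarith
  · have := hm i
    rcases (σ i).trichotomy with h | h | h <;> simp [boxCentre, h] <;> linarith
  · simp [boxCentre, h]
  · simp [boxCentre, h]

theorem boxFace_nonempty {k : ℕ} {m : Fin k → ℝ} (hm : ∀ i, 0 < m i) (σ : SignVec k) :
    (boxFace m σ).Nonempty := ⟨_, boxCentre_mem hm σ⟩

theorem boxFace_mono {k : ℕ} {m : Fin k → ℝ} {σ τ : SignVec k} (h : σ ≤ τ) :
    boxFace m σ ⊆ boxFace m τ := by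
  rintro x ⟨hx, hσ⟩
  refine ⟨hx, fun i => ⟨fun hi => (hσ i).1 ?_, fun hi => (hσ i).2 ?_⟩⟩
  · rw [h i (by rw [hi]; decide), hi]
  · rw [h i (by rw [hi]; decide), hi]

/-- The centre is a relative interior point: its coordinates reach an end of an edge only where `σ`
prescribes that end. -/
theorem le_of_boxCentre_mem {k : ℕ} {m : Fin k → ℝ} (hm : ∀ i, 0 < m i) {σ τ : SignVec k}
    (h : boxCentre m σ ∈ boxFace m τ) : σ ≤ τ := by
  intro i hi
  have hmi := hm i
  have hne := hmi.ne'
  obtain ⟨h₁, h₂⟩ := h.2 i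
  rcases (τ i).trichotomy with ht | ht | ht
  · have h₂ := h₂ ht
    rcases (σ i).trichotomy with hs | hs | hs
    · rw [hs, ht]
    · simp [boxCentre, hs, hne] at h₂
    · simp [boxCentre, hs, hne] at h₂
  · exact absurd ht hi
  · have h₁ := h₁ ht
    rcases (σ i).trichotomy with hs | hs | hs
    · simp [boxCentre, hs, hne.symm] at h₁
    · simp only [boxCentre, hs, SignType.coe_zero] at h₁
      linarith
    · rw [hs, ht]

theorem boxFace_subset_iff {k : ℕ} {m : Fin k → ℝ} (hm : ∀ i, 0 < m i) (σ τ : SignVec k) :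
    boxFace m σ ⊆ boxFace m τ ↔ σ ≤ τ :=
  ⟨fun h => le_of_boxCentre_mem hm (h (boxCentre_mem hm σ)), boxFace_mono⟩

/-- The label of the face of a box in which the functional with coefficients `c` is maximal. -/
noncomputable def signVecOf {k : ℕ} (c : Fin k → ℝ) : SignVec k :=
  ⟨fun i => SignType.sign (c i)⟩

/-- A linear functional on a box is maximised coordinate by coordinate, and only the sign of each
coefficient matters. -/
theorem boxFace_signVecOf {k : ℕ} {m : Fin k → ℝ} (hm : ∀ i, 0 < m i) (c : Fin k → ℝ) :
    {x | x ∈ Set.Icc 0 m ∧ ∀ y ∈ Set.Icc 0 m, ∑ i, c i * y i ≤ ∑ i, c i * x i} =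
      boxFace m (signVecOf c) := by
  ext x
  constructor
  · rintro ⟨hx, hmax⟩
    -- Changing a single coordinate of the maximiser stays in the box and isolates one term of the
    -- sum.
    have key : ∀ i s, 0 ≤ s → s ≤ m i → c i * s ≤ c i * x i := by
      intro i s hs hsm
      have hy : Function.update x i s ∈ Set.Icc 0 m := by
        refine ⟨fun j => ?_, fun j => ?_⟩
        · rcases eq_or_ne j i with rfl | hj
          · simpa using hs
          · simpa [hj] using hx.1 j
        · rcases eq_or_ne j i with rfl | hj
          · simpa using hsm
          · simpa [hj] using hx.2 j
      have h := hmax _ hy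
      rw [← Finset.add_sum_erase _ _ (Finset.mem_univ i),
        ← Finset.add_sum_erase Finset.univ (fun j => c j * x j) (Finset.mem_univ i)] at h
      have he : ∑ j ∈ Finset.univ.erase i, c j * Function.update x i s j =
          ∑ j ∈ Finset.univ.erase i, c j * x j :=
        Finset.sum_congr rfl fun j hj => by
          rw [Function.update_of_ne (Finset.ne_of_mem_erase hj)]
      rw [he] at h
      rw [Function.update_self] at h
      linarith
    refine ⟨hx, fun i => ⟨fun hi => ?_, fun hi => ?_⟩⟩
    · have hc : 0 < c i := sign_eq_one_iff.1 hi
      exact le_antisymm (hx.2 i) (le_of_mul_le_mul_left (key i (m i) (hm i).le le_rfl) hc)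
    · have hc : c i < 0 := sign_eq_neg_one_iff.1 hi
      have h := key i 0 le_rfl (hm i).le
      have h0 : 0 ≤ x i := hx.1 i
      nlinarith
  · rintro ⟨hx, hσ⟩
    refine ⟨hx, fun y hy => Finset.sum_le_sum fun i _ => ?_⟩
    have h0 : 0 ≤ y i := hy.1 i
    have h1 : y i ≤ m i := hy.2 i
    rcases lt_trichotomy (c i) 0 with hc | hc | hc
    · rw [(hσ i).2 (sign_eq_neg_one_iff.2 hc)]
      nlinarith
    · simp [hc]
    · rw [(hσ i).1 (sign_eq_one_iff.2 hc)]
      nlinarith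

theorem strongDual_apply_eq_sum {k : ℕ} (l : StrongDual ℝ (Fin k → ℝ)) (x : Fin k → ℝ) :
    l x = ∑ i, l (Pi.single i 1) * x i := by
  conv_lhs => rw [pi_eq_sum_univ' x]
  simp [mul_comm]

/-- The continuous linear functional with coefficients `c`. -/
noncomputable def functionalOf {k : ℕ} (c : Fin k → ℝ) : StrongDual ℝ (Fin k → ℝ) :=
  ∑ i, c i • ContinuousLinearMap.proj (R := ℝ) (φ := fun _ : Fin k => ℝ) i

theorem functionalOf_apply {k : ℕ} (c x : Fin k → ℝ) : functionalOf c x = ∑ i, c i * x i := by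
  simp [functionalOf]

theorem mem_faces_box {k : ℕ} {m : Fin k → ℝ} (hm : ∀ i, 0 < m i) (G : Set (Fin k → ℝ)) :
    G ∈ faces (Set.Icc 0 m) ↔ G = ∅ ∨ ∃ σ, G = boxFace m σ := by
  constructor
  · intro hG
    rcases G.eq_empty_or_nonempty with h | h
    · exact Or.inl h
    · obtain ⟨l, hl⟩ := hG h
      refine Or.inr ⟨signVecOf fun i => l (Pi.single i 1), ?_⟩
      rw [← boxFace_signVecOf hm, hl]
      ext x
      simp only [Set.mem_ofPred_eq, ← strongDual_apply_eq_sum l]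
  · rintro (rfl | ⟨σ, rfl⟩)
    · exact fun h => absurd h Set.not_nonempty_empty
    · intro _
      refine ⟨functionalOf fun i => ((σ i : SignType) : ℝ), ?_⟩
      simp only [functionalOf_apply, boxFace_signVecOf hm]
      congr 1
      ext i : 2
      simp only [signVecOf]
      rcases (σ i).trichotomy with h | h | h <;> simp [h]

/-! ### Outer boundaries of casks -/

/-- `F` labels the nonempty faces of `Q` by sign vectors, as for a cube. -/
structure IsCubeLabelling {n k : ℕ} (Q : Set (Fin n → ℝ)) (F : SignVec k → Set (Fin n → ℝ)) :
    Prop where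
  mem_faces : ∀ G, G ∈ faces Q ↔ G = ∅ ∨ ∃ σ, G = F σ
  nonempty : ∀ σ, (F σ).Nonempty
  subset_iff : ∀ σ τ, F σ ⊆ F τ ↔ σ ≤ τ

theorem IsCuboid.exists_labelling {n k : ℕ} {Q : Set (Fin n → ℝ)} (hQ : IsCuboid k Q) :
    ∃ F : SignVec k → Set (Fin n → ℝ), IsCubeLabelling Q F := by
  obtain ⟨-, ⟨φ⟩⟩ := hQ
  have h1 : ∀ i : Fin k, (0 : ℝ) < (1 : Fin k → ℝ) i := fun _ => one_pos
  have hmem : ∀ σ : SignVec k, boxFace 1 σ ∈ faces (stdCube k) := fun σ =>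
    (mem_faces_box h1 _).2 (Or.inr ⟨σ, rfl⟩)
  have hemp : ∅ ∈ faces (stdCube k) := (mem_faces_box h1 _).2 (Or.inl rfl)
  have hempQ : ∅ ∈ faces Q := fun h => absurd h Set.not_nonempty_empty
  have hbot : (φ.symm ⟨∅, hemp⟩ : Set (Fin n → ℝ)) = ∅ := by
    have h : (⟨∅, hemp⟩ : faces (stdCube k)) ≤ φ ⟨∅, hempQ⟩ := Set.empty_subset _
    rw [← φ.symm_apply_le] at h
    exact Set.subset_empty_iff.1 h
  refine ⟨fun σ => φ.symm ⟨boxFace 1 σ, hmem σ⟩, fun G => ⟨fun hG => ?_, ?_⟩, fun σ => ?_,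
    fun σ τ => ?_⟩
  · rcases (mem_faces_box h1 _).1 (φ ⟨G, hG⟩).2 with h | ⟨σ, h⟩
    · left
      have : φ ⟨G, hG⟩ = ⟨∅, hemp⟩ := Subtype.ext h
      rw [← hbot, ← this, φ.symm_apply_apply]
    · right
      refine ⟨σ, ?_⟩
      have : φ ⟨G, hG⟩ = ⟨boxFace 1 σ, hmem σ⟩ := Subtype.ext h
      rw [← this, φ.symm_apply_apply]
  · rintro (rfl | ⟨σ, rfl⟩)
    · exact hempQ
    · exact (φ.symm _).2
  · rw [Set.nonempty_iff_ne_empty, ← hbot]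
    intro h
    have h := congrArg Subtype.val (φ.symm.injective (Subtype.ext h))
    exact (boxFace_nonempty h1 σ).ne_empty h
  · rw [← boxFace_subset_iff h1]
    exact φ.symm.le_iff_le (x := ⟨_, hmem σ⟩) (y := ⟨_, hmem τ⟩)

/-- The sign vector with the single nonzero entry `s` at `i`. -/
def SignVec.single {k : ℕ} (i : Fin k) (s : SignType) : SignVec k :=
  ⟨fun j => if j = i then s else 0⟩

theorem SignVec.le_single_iff {k : ℕ} {i : Fin k} {s : SignType} (hs : s ≠ 0) {σ : SignVec k} :
    σ ≤ SignVec.single i s ↔ σ i = s := by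
  constructor
  · intro h
    simpa [SignVec.single] using h i (by simpa [SignVec.single] using hs)
  · intro h j hj
    by_cases hji : j = i
    · subst hji
      simpa [SignVec.single] using h
    · simp [SignVec.single, hji] at hj

namespace IsCubeLabelling

variable {n k : ℕ} {Q : Set (Fin n → ℝ)} {F : SignVec k → Set (Fin n → ℝ)}

theorem injective (h : IsCubeLabelling Q F) : Function.Injective F := fun σ τ e =>
  le_antisymm ((h.subset_iff σ τ).1 e.subset) ((h.subset_iff τ σ).1 e.symm.subset)

theorem eq_top (h : IsCubeLabelling Q F) (hQ : Q.Nonempty) : Q = F ⟨fun _ => 0⟩ := by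
  have hmem : Q ∈ faces Q := fun _ => ⟨0, by simp⟩
  rcases (h.mem_faces Q).1 hmem with e | ⟨σ, e⟩
  · exact absurd e hQ.ne_empty
  · refine Set.Subset.antisymm ?_ ?_
    · rw [e, h.subset_iff]
      intro i hi
      exact absurd rfl hi
    · exact IsExposed.subset ((h.mem_faces _).2 (Or.inr ⟨_, rfl⟩))

theorem mem_facets_iff (h : IsCubeLabelling Q F) (hk : 0 < k) (hQ : Q.Nonempty)
    (G : Set (Fin n → ℝ)) :
    G ∈ facets Q ↔ ∃ i s, s ≠ 0 ∧ G = F (SignVec.single i s) := by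
  have hmem : ∀ i s, s ≠ 0 → F (SignVec.single i s) ∈ boundaryComplex Q := by
    intro i s hs
    refine ⟨(h.mem_faces _).2 (Or.inr ⟨_, rfl⟩), fun e => ?_⟩
    rw [h.eq_top hQ] at e
    have := congrFun (congrArg SignVec.sign (h.injective e)) i
    simp [SignVec.single] at this
    exact hs this
  have hle : ∀ σ, F σ ∈ boundaryComplex Q → ∃ i s, s ≠ 0 ∧ σ ≤ SignVec.single i s := by
    intro σ hσ
    have : ∃ i, σ i ≠ 0 := by
      by_contra! hc
      apply hσ.2
      rw [h.eq_top hQ]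
      congr 1
      ext i : 2
      exact hc i
    obtain ⟨i, hi⟩ := this
    exact ⟨i, σ i, hi, (SignVec.le_single_iff hi).2 rfl⟩
  constructor
  · rintro ⟨hG, hmax⟩
    rcases (h.mem_faces G).1 hG.1 with rfl | ⟨σ, rfl⟩
    · have := hmax (hmem ⟨0, hk⟩ 1 (by decide)) (Set.empty_subset _)
      exact absurd (Set.subset_empty_iff.1 this) (h.nonempty _).ne_empty
    · obtain ⟨i, s, hs, hle⟩ := hle σ hG
      have hsub := (h.subset_iff _ _).2 hle
      exact ⟨i, s, hs, Set.Subset.antisymm hsub (hmax (hmem i s hs) hsub)⟩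
  · rintro ⟨i, s, hs, rfl⟩
    refine ⟨hmem i s hs, fun G hG hsub => ?_⟩
    rcases (h.mem_faces G).1 hG.1 with rfl | ⟨σ, rfl⟩
    · exact Set.empty_subset _
    · obtain ⟨j, s', hs', hle⟩ := hle σ hG
      have h1 := ((h.subset_iff _ _).1 hsub).trans hle
      rw [SignVec.le_single_iff hs'] at h1
      by_cases hij : j = i
      · subst hij
        simp only [SignVec.single, if_true] at h1
        rw [h1]
        exact (h.subset_iff _ _).2 hle
      · simp [SignVec.single, hij] at h1
        exact absurd h1.symm hs'

/-- Filling a zero entry of the label would give a strictly smaller nonempty face, which a singleton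
does not have. -/
theorem exists_vertex_label (h : IsCubeLabelling Q F) {V : Fin n → ℝ} (hV : IsVertex Q V) :
    ∃ v, (∀ i, v i ≠ 0) ∧ {V} = F v := by
  rcases (h.mem_faces _).1 hV with e | ⟨v, e⟩
  · exact absurd e (Set.singleton_ne_empty V)
  · refine ⟨v, fun i hi => ?_, e⟩
    let τ : SignVec k := ⟨Function.update v i 1⟩
    have hτ : τ ≤ v := by
      intro j hj
      have : j ≠ i := fun hji => hj (hji ▸ hi)
      simp [τ, this]
    have hsub := (h.subset_iff _ _).2 hτ
    rw [← e] at hsub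
    rcases Set.subset_singleton_iff_eq.1 hsub with h0 | h0
    · exact (h.nonempty τ).ne_empty h0
    · have := congrFun (congrArg SignVec.sign (h.injective (h0.trans e))) i
      simp [τ, hi] at this

theorem mem_cask_iff (h : IsCubeLabelling Q F) (hk : 0 < k) {V : Fin n → ℝ} {v : SignVec k}
    (hv : ∀ i, v i ≠ 0) (hV : {V} = F v) (G : Set (Fin n → ℝ)) :
    G ∈ cask Q V ↔ G = ∅ ∨ ∃ σ, G = F σ ∧ ∃ i, σ i = v i := by
  have hface : F v ∈ faces Q := (h.mem_faces _).2 (Or.inr ⟨v, rfl⟩)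
  have hQ : Q.Nonempty := (h.nonempty v).mono (IsExposed.subset hface)
  have hVF : ∀ i s, s ≠ 0 → (V ∈ F (SignVec.single i s) ↔ v i = s) := fun i s hs => by
    rw [← Set.singleton_subset_iff, hV, h.subset_iff, SignVec.le_single_iff hs]
  constructor
  · rintro ⟨hG, F', hF', hVF', hsub⟩
    obtain ⟨i, s, hs, rfl⟩ := (h.mem_facets_iff hk hQ _).1 hF'
    rcases (h.mem_faces G).1 hG with e | ⟨σ, rfl⟩
    · exact Or.inl e
    · refine Or.inr ⟨σ, rfl, i, ?_⟩
      rw [(hVF i s hs).1 hVF']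
      exact (SignVec.le_single_iff hs).1 ((h.subset_iff _ _).1 hsub)
  · have hfac : ∀ i, F (SignVec.single i (v i)) ∈ facets Q := fun i =>
      (h.mem_facets_iff hk hQ _).2 ⟨i, v i, hv i, rfl⟩
    rintro (rfl | ⟨σ, rfl, i, hi⟩)
    · exact ⟨(h.mem_faces _).2 (Or.inl rfl), _, hfac ⟨0, hk⟩, (hVF _ _ (hv _)).2 rfl,
        Set.empty_subset _⟩
    · exact ⟨(h.mem_faces _).2 (Or.inr ⟨σ, rfl⟩), _, hfac i, (hVF _ _ (hv _)).2 rfl,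
        (h.subset_iff _ _).2 ((SignVec.le_single_iff (hv i)).2 hi)⟩

theorem maximal_cask_iff (h : IsCubeLabelling Q F) (hk : 0 < k) {V : Fin n → ℝ} {v : SignVec k}
    (hv : ∀ i, v i ≠ 0) (hV : {V} = F v) (G : Set (Fin n → ℝ)) :
    Maximal (fun G => G ∈ cask Q V) G ↔ ∃ i, G = F (SignVec.single i (v i)) := by
  have hmem : ∀ i, F (SignVec.single i (v i)) ∈ cask Q V := fun i =>
    (h.mem_cask_iff hk hv hV _).2 (Or.inr ⟨_, rfl, i, by simp [SignVec.single]⟩)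
  constructor
  · rintro ⟨hG, hmax⟩
    rcases (h.mem_cask_iff hk hv hV G).1 hG with rfl | ⟨σ, rfl, i, hi⟩
    · have := hmax (hmem ⟨0, hk⟩) (Set.empty_subset _)
      exact absurd (Set.subset_empty_iff.1 this) (h.nonempty _).ne_empty
    · have hsub := (h.subset_iff _ _).2 ((SignVec.le_single_iff (hv i)).2 hi)
      exact ⟨i, Set.Subset.antisymm hsub (hmax (hmem i) hsub)⟩
  · rintro ⟨i, rfl⟩
    refine ⟨hmem i, fun G hG hsub => ?_⟩
    rcases (h.mem_cask_iff hk hv hV G).1 hG with rfl | ⟨σ, rfl, j, hj⟩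
    · exact Set.empty_subset _
    · have hle := (SignVec.le_single_iff (hv j)).2 hj
      have h1 := ((h.subset_iff _ _).1 hsub).trans hle
      rw [SignVec.le_single_iff (hv j)] at h1
      by_cases hij : j = i
      · subst hij
        exact (h.subset_iff _ _).2 hle
      · simp [SignVec.single, hij] at h1
        exact absurd h1.symm (hv j)

/-- This ridge lies in two facets of `Q`: the one at `i` contains `V`, while the one at `j` is
opposite to a facet through `V` and so is not in the cask. -/
theorem isFreeRidge_of_pair (h : IsCubeLabelling Q F) (hk : 0 < k) {V : Fin n → ℝ}
    {v : SignVec k} (hv : ∀ i, v i ≠ 0) (hV : {V} = F v) {i j : Fin k} (hij : i ≠ j) :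
    IsFreeRidge (cask Q V)
      (F ⟨fun a => if a = i then v i else if a = j then -v j else 0⟩) := by
  set σ : SignVec k := ⟨fun a => if a = i then v i else if a = j then -v j else 0⟩ with hσ
  have hneg : ∀ s : SignType, s ≠ 0 → s ≠ -s := by decide
  have hσi : σ i = v i := by simp [hσ]
  have hσj : σ j = -v j := by simp [hσ, hij.symm]
  have hle : σ ≤ SignVec.single i (v i) := (SignVec.le_single_iff (hv i)).2 hσi
  refine ⟨(h.mem_cask_iff hk hv hV _).2 (Or.inr ⟨σ, rfl, i, hσi⟩), F (SignVec.single i (v i)),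
    (h.maximal_cask_iff hk hv hV _).2 ⟨i, rfl⟩, ?_, ?_, ?_⟩
  · refine ((h.subset_iff _ _).2 hle).ssubset_of_ne fun e => ?_
    have := congrFun (congrArg SignVec.sign (h.injective e)) j
    rw [hσj] at this
    simp [SignVec.single, hij.symm, hv j] at this
  · rintro G hG ⟨h1, h2⟩
    rcases (h.mem_cask_iff hk hv hV G).1 hG with rfl | ⟨γ, rfl, -⟩
    · exact (h.nonempty σ).ne_empty (Set.subset_empty_iff.1 h1.1)
    · have hγσ := (h.subset_iff _ _).1 h1.1
      have hγi := (SignVec.le_single_iff (hv i)).1 ((h.subset_iff _ _).1 h2.1)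
      -- An intermediate label is fixed at `i` and can only vary at `j`: a zero there gives the
      -- facet, a nonzero sign gives the ridge.
      by_cases hγj : γ j = 0
      · apply h2.2
        rw [h.subset_iff]
        intro a ha
        by_cases hai : a = i
        · subst hai
          simp [SignVec.single, hγi]
        · by_cases haj : a = j
          · exact absurd (haj ▸ hγj) ha
          · have := hγσ a ha
            simp only [hσ, hai, haj, if_false] at this
            exact absurd this.symm ha
      · apply h1.2
        rw [h.subset_iff]
        intro a ha
        by_cases hai : a = i
        · subst hai
          rw [hγi, hσi]
        · by_cases haj : a = j
          · subst haj
            exact (hγσ a hγj).symm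
          · simp [hσ, hai, haj] at ha
  · intro F' hF' hsub
    obtain ⟨b, rfl⟩ := (h.maximal_cask_iff hk hv hV _).1 hF'
    have hb := (SignVec.le_single_iff (hv b)).1 ((h.subset_iff _ _).1 hsub)
    by_cases hbi : b = i
    · rw [hbi]
    · by_cases hbj : b = j
      · subst hbj
        rw [hσj] at hb
        exact absurd hb.symm (hneg _ (hv b))
      · simp only [hσ, hbi, hbj, if_false] at hb
        exact absurd hb.symm (hv b)

/-- A free ridge inside the cask facet at `i` has a second nonzero entry `j`. Were it equal to `v
j`, the ridge would also lie in the cask facet at `j`. -/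
theorem mem_outerComplex_iff (h : IsCubeLabelling Q F) (hk : 2 ≤ k) {V : Fin n → ℝ}
    {v : SignVec k} (hv : ∀ i, v i ≠ 0) (hV : {V} = F v) (G : Set (Fin n → ℝ)) :
    G ∈ outerComplex (cask Q V) ↔
      G = ∅ ∨ ∃ σ, G = F σ ∧ (∃ i, σ i = v i) ∧ ∃ j, σ j = -v j := by
  have hk0 : 0 < k := by omega
  have hneg : ∀ s : SignType, s ≠ 0 → s ≠ -s := by decide
  constructor
  · rintro ⟨hG, R, ⟨hR, F', hF', hRF', hcov, huniq⟩, hGR⟩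
    obtain ⟨i, rfl⟩ := (h.maximal_cask_iff hk0 hv hV _).1 hF'
    rcases (h.mem_cask_iff hk0 hv hV R).1 hR with rfl | ⟨ρ, rfl, -⟩
    · exact Or.inl (Set.subset_empty_iff.1 hGR)
    · have hρi := (SignVec.le_single_iff (hv i)).1 ((h.subset_iff _ _).1 hRF'.1)
      have hex : ∃ j, j ≠ i ∧ ρ j ≠ 0 := by
        by_contra! hc
        apply hRF'.2
        rw [h.subset_iff]
        intro a ha
        by_cases hai : a = i
        · subst hai
          simp [SignVec.single, hρi]
        · exact absurd (hc a hai) ha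
      obtain ⟨j, hji, hρj⟩ := hex
      have hρv : ρ j = -v j := by
        by_contra hne
        have heq : ρ j = v j := by
          have hdich : ∀ r s : SignType, r ≠ 0 → s ≠ 0 → r ≠ -s → r = s := by decide
          exact hdich _ _ hρj (hv j) hne
        have e := huniq _ ((h.maximal_cask_iff hk0 hv hV _).2 ⟨j, rfl⟩)
          ((h.subset_iff _ _).2 ((SignVec.le_single_iff (hv j)).2 heq))
        have := congrFun (congrArg SignVec.sign (h.injective e)) j
        simp [SignVec.single, hji, hv j] at this
      rcases (h.mem_cask_iff hk0 hv hV G).1 hG with e | ⟨τ, rfl, -⟩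
      · exact Or.inl e
      · have hle := (h.subset_iff _ _).1 hGR
        refine Or.inr ⟨τ, rfl, ⟨i, ?_⟩, ⟨j, ?_⟩⟩
        · rw [hle i (by rw [hρi]; exact hv i), hρi]
        · rw [hle j hρj, hρv]
  · rintro (rfl | ⟨σ, rfl, ⟨i, hi⟩, ⟨j, hj⟩⟩)
    -- The empty face needs some free ridge above it; two distinct coordinates, hence `2 ≤ k`,
    -- provide one.
    · exact ⟨(h.mem_cask_iff hk0 hv hV _).2 (Or.inl rfl), _,
        h.isFreeRidge_of_pair hk0 hv hV (i := ⟨0, by omega⟩) (j := ⟨1, by omega⟩) (by simp),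
        Set.empty_subset _⟩
    · have hij : i ≠ j := by
        rintro rfl
        exact hneg _ (hv i) (hi.symm.trans hj)
      refine ⟨(h.mem_cask_iff hk0 hv hV _).2 (Or.inr ⟨σ, rfl, i, hi⟩), _,
        h.isFreeRidge_of_pair hk0 hv hV hij, (h.subset_iff _ _).2 fun a ha => ?_⟩
      by_cases hai : a = i
      · subst hai
        simpa using hi
      · by_cases haj : a = j
        · subst haj
          simpa [hai] using hj
        · simp [hai, haj] at ha

/-- The outer boundary of a cask is labelled by the sign vectors in which both signs occur. -/
theorem nonempty_outerComplex_orderIso (h : IsCubeLabelling Q F) (hk : 2 ≤ k) {V : Fin n → ℝ}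
    (hV : IsVertex Q V) :
    Nonempty (outerComplex (cask Q V) ≃o WithBot {σ : SignVec k // σ.Mixed}) := by
  obtain ⟨v, hv, hVv⟩ := h.exists_vertex_label hV
  -- This reflection moves `V` to the all-ones vertex; it is an involution because `v` has no zero
  -- entry.
  let flip : SignVec k → SignVec k := fun σ => ⟨fun i => σ i * v i⟩
  have hsq : ∀ s t : SignType, t ≠ 0 → s * t * t = s := by decide
  have hff : ∀ σ, flip (flip σ) = σ := fun σ => SignVec.ext (funext fun i => hsq _ _ (hv i))
  have hmono : ∀ σ τ, σ ≤ τ → flip σ ≤ flip τ := by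
    intro σ τ hστ i hi
    exact congrArg (· * v i) (hστ i fun h0 => hi (by simp [flip, h0]))
  refine nonempty_orderIso_withBot (fun σ : {σ : SignVec k // σ.Mixed} => F (flip σ.1))
    (fun σ => h.nonempty _) (fun σ τ => ?_) _ fun G => ?_
  · rw [h.subset_iff]
    refine ⟨fun hle => ?_, hmono _ _⟩
    have := hmono _ _ hle
    rwa [hff, hff] at this
  · rw [h.mem_outerComplex_iff hk hv hVv]
    refine or_congr_right ⟨?_, ?_⟩
    · rintro ⟨σ, rfl, ⟨i, hi⟩, ⟨j, hj⟩⟩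
      have h1 : ∀ t : SignType, t ≠ 0 → t * t = 1 ∧ -t * t = -1 := by decide
      refine ⟨⟨flip σ, ⟨i, ?_⟩, ⟨j, ?_⟩⟩, ?_⟩
      · simpa only [flip, hi] using (h1 _ (hv i)).1
      · simpa only [flip, hj] using (h1 _ (hv j)).2
      · simp only [hff]
    · rintro ⟨⟨σ, ⟨i, hi⟩, ⟨j, hj⟩⟩, rfl⟩
      refine ⟨_, rfl, ⟨i, ?_⟩, ⟨j, ?_⟩⟩
      · simp [flip, hi]
      · simp [flip, hj]

end IsCubeLabelling

/-! ### Projections of boxes along the diagonal -/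

/-- The projection of `ℝᵈ⁺¹` onto `ℝᵈ` along the diagonal, followed by the translation by `b`. -/
def diagProj {d : ℕ} (b : Fin d → ℝ) (w : Fin (d + 1) → ℝ) : Fin d → ℝ :=
  fun i => w i.castSucc - w (Fin.last d) + b i

theorem diagProj_eq_iff {d : ℕ} {b : Fin d → ℝ} {w w' : Fin (d + 1) → ℝ}
    (h : diagProj b w = diagProj b w') :
    ∀ i, w i = w' i + (w (Fin.last d) - w' (Fin.last d)) := by
  intro i
  refine Fin.lastCases ?_ (fun j => ?_) i
  · ring
  · have := congrFun h j
    simp only [diagProj] at this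
    linarith

/-- Fibres of the projection are diagonal lines. From the centre of a mixed face no diagonal shift
stays in the box: the coordinate at its upper end blocks moving up, the one at its lower end blocks
moving down. -/
theorem diagProj_boxFace_subset_iff {d : ℕ} {b : Fin d → ℝ} {m : Fin (d + 1) → ℝ}
    (hm : ∀ i, 0 < m i) {σ : SignVec (d + 1)} (hσ : σ.Mixed) (τ : SignVec (d + 1)) :
    diagProj b '' boxFace m σ ⊆ diagProj b '' boxFace m τ ↔ σ ≤ τ := by
  refine ⟨fun h => ?_, fun h => Set.image_mono (boxFace_mono h)⟩
  have hc := boxCentre_mem hm σ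
  obtain ⟨w, hw, e⟩ := h ⟨_, hc, rfl⟩
  have e := diagProj_eq_iff e
  obtain ⟨⟨i, hi⟩, ⟨j, hj⟩⟩ := hσ
  have hi' := (hc.2 i).1 hi
  have hj' := (hc.2 j).2 hj
  have h1 : w i ≤ m i := hw.1.2 i
  have h2 : 0 ≤ w j := hw.1.1 j
  have h3 := e i
  have h4 := e j
  have hwc : w = boxCentre m σ := by
    funext a
    rw [e a]
    linarith
  exact le_of_boxCentre_mem hm (hwc ▸ hw)

/-- Zero-sum coefficients are those of functionals vanishing on the diagonal, so they descend
through the projection. -/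
theorem diagProj_functional {d : ℕ} (b : Fin d → ℝ) {c : Fin (d + 1) → ℝ} (hc : ∑ i, c i = 0)
    (w : Fin (d + 1) → ℝ) :
    ∑ i : Fin d, c i.castSucc * diagProj b w i =
      ∑ i, c i * w i + ∑ i : Fin d, c i.castSucc * b i := by
  rw [Fin.sum_univ_castSucc] at hc
  rw [Fin.sum_univ_castSucc (fun i => c i * w i)]
  have : c (Fin.last d) = -∑ i : Fin d, c i.castSucc := by linarith
  rw [this]
  simp only [diagProj, mul_add, mul_sub, Finset.sum_add_distrib, Finset.sum_sub_distrib,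
    ← Finset.sum_mul]
  ring

theorem argmax_diagProj {d : ℕ} (b : Fin d → ℝ) {m : Fin (d + 1) → ℝ} (hm : ∀ i, 0 < m i)
    {c : Fin (d + 1) → ℝ} (hc : ∑ i, c i = 0) :
    {x | x ∈ diagProj b '' Set.Icc 0 m ∧ ∀ y ∈ diagProj b '' Set.Icc 0 m,
        ∑ i : Fin d, c i.castSucc * y i ≤ ∑ i : Fin d, c i.castSucc * x i} =
      diagProj b '' boxFace m (signVecOf c) := by
  rw [← boxFace_signVecOf hm]
  ext x
  constructor
  · rintro ⟨⟨w, hw, rfl⟩, hmax⟩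
    refine ⟨w, ⟨hw, fun y hy => ?_⟩, rfl⟩
    have := hmax _ ⟨y, hy, rfl⟩
    rw [diagProj_functional b hc, diagProj_functional b hc] at this
    linarith
  · rintro ⟨w, ⟨hw, hmax⟩, rfl⟩
    refine ⟨⟨w, hw, rfl⟩, ?_⟩
    rintro _ ⟨y, hy, rfl⟩
    rw [diagProj_functional b hc, diagProj_functional b hc]
    linarith [hmax y hy]

/-- Every sign vector in which both signs occur is that of a vector with coordinate sum zero. -/
theorem SignVec.Mixed.exists_sum_eq_zero {k : ℕ} {σ : SignVec k} (hσ : σ.Mixed) :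
    ∃ c : Fin k → ℝ, ∑ i, c i = 0 ∧ signVecOf c = σ := by
  classical
  obtain ⟨⟨i, hi⟩, ⟨j, hj⟩⟩ := hσ
  have hp : 0 < ((Finset.univ.filter fun a => σ a = 1).card : ℝ) :=
    Nat.cast_pos.2 (Finset.card_pos.2 ⟨i, by simpa using hi⟩)
  have hq : 0 < ((Finset.univ.filter fun a => σ a = -1).card : ℝ) :=
    Nat.cast_pos.2 (Finset.card_pos.2 ⟨j, by simpa using hj⟩)
  set p := ((Finset.univ.filter fun a => σ a = 1).card : ℝ) with hpdef
  set q := ((Finset.univ.filter fun a => σ a = -1).card : ℝ) with hqdef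
  -- With `p` positive and `q` negative entries, the weights `q` and `-p` balance.
  refine ⟨fun a => (if σ a = 1 then q else 0) + (if σ a = -1 then -p else 0), ?_, ?_⟩
  · rw [Finset.sum_add_distrib, ← Finset.sum_filter, ← Finset.sum_filter, Finset.sum_const,
      Finset.sum_const, nsmul_eq_mul, nsmul_eq_mul, ← hpdef, ← hqdef]
    ring
  · ext a : 2
    simp only [signVecOf]
    rcases (σ a).trichotomy with h | h | h
    · rw [h]
      simpa [sign_eq_neg_one_iff] using hp
    · rw [h]
      simp
    · rw [h]
      simpa [sign_eq_one_iff] using hq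

theorem signVecOf_mixed {k : ℕ} {c : Fin k → ℝ} (hc : ∑ i, c i = 0) (h0 : c ≠ 0) :
    (signVecOf c).Mixed := by
  obtain ⟨i, hi⟩ := Function.ne_iff.1 h0
  obtain ⟨a, -, ha⟩ := Finset.exists_pos_of_sum_zero_of_exists_nonzero c hc
    ⟨i, Finset.mem_univ i, hi⟩
  have hc' : ∑ i, (-c) i = 0 := by simp [hc]
  obtain ⟨b, -, hb⟩ := Finset.exists_pos_of_sum_zero_of_exists_nonzero (-c) hc'
    ⟨i, Finset.mem_univ i, by simpa using hi⟩
  exact ⟨⟨a, sign_eq_one_iff.2 ha⟩, ⟨b, sign_eq_neg_one_iff.2 (by simpa using hb)⟩⟩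

theorem mem_boundaryComplex_diagProj {d : ℕ} (b : Fin d → ℝ) {m : Fin (d + 1) → ℝ}
    (hm : ∀ i, 0 < m i) (G : Set (Fin d → ℝ)) :
    G ∈ boundaryComplex (diagProj b '' Set.Icc 0 m) ↔
      G = ∅ ∨ ∃ σ : {σ : SignVec (d + 1) // σ.Mixed}, G = diagProj b '' boxFace m σ.1 := by
  have hP : (diagProj b '' Set.Icc 0 m).Nonempty :=
    ⟨_, 0, ⟨le_rfl, fun i => (hm i).le⟩, rfl⟩
  have htop : Set.Icc 0 m = boxFace m ⟨fun _ => 0⟩ := by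
    ext x
    simp [boxFace]
  constructor
  · rintro ⟨hG, hne⟩
    rcases G.eq_empty_or_nonempty with h | h
    · exact Or.inl h
    · obtain ⟨l, hl⟩ := hG h
      -- The last coefficient is chosen to make the sum zero. The case `c = 0` yields the improper
      -- face.
      let c : Fin (d + 1) → ℝ := Fin.snoc (α := fun _ => ℝ) (fun i => l (Pi.single i 1))
        (-∑ i, l (Pi.single i 1))
      have hci : ∀ i : Fin d, c i.castSucc = l (Pi.single i 1) := fun i => by simp [c]
      have hc : ∑ i, c i = 0 := by
        rw [Fin.sum_univ_castSucc]
        simp [c]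
      have hG' : G = diagProj b '' boxFace m (signVecOf c) := by
        rw [← argmax_diagProj b hm hc, hl]
        ext x
        simp only [Set.mem_ofPred_eq, hci, ← strongDual_apply_eq_sum l]
      by_cases h0 : c = 0
      · refine absurd ?_ hne
        rw [hG', htop]
        congr 2
        ext i : 2
        simp [signVecOf, h0]
      · exact Or.inr ⟨⟨_, signVecOf_mixed hc h0⟩, hG'⟩
  · rintro (rfl | ⟨⟨σ, hσ⟩, rfl⟩)
    · exact ⟨fun h => absurd h Set.not_nonempty_empty, hP.ne_empty.symm⟩
    · refine ⟨fun _ => ?_, fun e => ?_⟩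
      · obtain ⟨c, hc, rfl⟩ := hσ.exists_sum_eq_zero
        refine ⟨functionalOf fun i => c i.castSucc, ?_⟩
        simp only [functionalOf_apply]
        exact (argmax_diagProj b hm hc).symm
      -- If the image of this face were everything, it would contain the image of the opposite face,
      -- forcing `-σ ≤ σ`.
      · have hneg : SignVec.Mixed (⟨fun i => -σ i⟩ : SignVec (d + 1)) := by
          obtain ⟨⟨i, hi⟩, ⟨j, hj⟩⟩ := hσ
          exact ⟨⟨j, by simp [hj]⟩, ⟨i, by simp [hi]⟩⟩
        have hle : (⟨fun i => -σ i⟩ : SignVec (d + 1)) ≤ σ := by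
          rw [← diagProj_boxFace_subset_iff (b := b) hm hneg]
          dsimp only at e
          rw [e]
          exact Set.image_mono fun x hx => hx.1
        obtain ⟨⟨i, hi⟩, -⟩ := hσ
        have := hle i (by rw [hi]; decide)
        simp [hi] at this

/-- The boundary complex of the projection of a `(d + 1)`-dimensional box along the diagonal is
labelled by the sign vectors in which both signs occur. -/
theorem nonempty_boundaryComplex_diagProj_orderIso {d : ℕ} (b : Fin d → ℝ)
    {m : Fin (d + 1) → ℝ} (hm : ∀ i, 0 < m i) :
    Nonempty (boundaryComplex (diagProj b '' Set.Icc 0 m) ≃o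
      WithBot {σ : SignVec (d + 1) // σ.Mixed}) :=
  nonempty_orderIso_withBot (fun σ => diagProj b '' boxFace m σ.1)
    (fun _ => (boxFace_nonempty hm _).image _)
    (fun σ _ => diagProj_boxFace_subset_iff hm σ.2 _) _ (mem_boundaryComplex_diagProj b hm)

/-! ### Alcoved polytopes -/

theorem isPolyhedron_of_fintype {n : ℕ} {ι : Type*} [Fintype ι]
    (c : ι → ((Fin n → ℝ) →ₗ[ℝ] ℝ)) (b : ι → ℝ) : IsPolyhedron {x | ∀ k, c k x ≤ b k} := by
  let e := Fintype.equivFin ι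
  refine ⟨Fintype.card ι, fun k => c (e.symm k), fun k => b (e.symm k), ?_⟩
  ext x
  exact e.symm.forall_congr_right (q := fun k => c k x ≤ b k) |>.symm

theorem isPolytope_alcoved {d : ℕ} (A : Matrix (Fin (d + 1)) (Fin (d + 1)) ℝ) :
    IsPolytope (alcoved A) := by
  constructor
  · let p : Fin d → ((Fin d → ℝ) →ₗ[ℝ] ℝ) := fun i => LinearMap.proj i
    have h := isPolyhedron_of_fintype
      (Sum.elim (Sum.elim (fun i => -p i) p)
        (Sum.elim (fun ij : Fin d × Fin d => p ij.2 - p ij.1) fun ij : Fin d × Fin d =>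
          p ij.1 - p ij.2))
      (Sum.elim (Sum.elim (fun i => -A i.castSucc (Fin.last d)) fun i =>
          -A (Fin.last d) i.castSucc)
        (Sum.elim (fun ij : Fin d × Fin d => -A ij.1.castSucc ij.2.castSucc) fun ij : Fin d × Fin d =>
          -A ij.2.castSucc ij.1.castSucc))
    convert h using 1
    ext x
    simp only [alcoved, Set.mem_ofPred_eq, Sum.forall, Sum.elim_inl, Sum.elim_inr, Prod.forall, p,
      LinearMap.neg_apply, LinearMap.sub_apply, LinearMap.proj_apply, neg_le_neg_iff]
    constructor
    · rintro ⟨h1, h2⟩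
      exact ⟨⟨fun i => (h1 i).1, fun i => (h1 i).2⟩,
        fun i j => by linarith [(h2 i j).1], fun i j => (h2 i j).2⟩
    · rintro ⟨⟨h1, h2⟩, h3, h4⟩
      exact ⟨fun i => ⟨h1 i, h2 i⟩, fun i j => ⟨by linarith [h3 i j], h4 i j⟩⟩
  · refine (Metric.isBounded_Icc (fun i : Fin d => A i.castSucc (Fin.last d))
      (fun i => -A (Fin.last d) i.castSucc)).subset fun x hx => ?_
    exact ⟨fun i => (hx.1 i).1, fun i => (hx.1 i).2⟩

/-- An isocanted alcoved polytope is the projection of a box along the diagonal. -/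
theorem alcoved_eq_diagProj {d : ℕ} {A : Matrix (Fin (d + 1)) (Fin (d + 1)) ℝ} {t l : Fin d → ℝ}
    {a : ℝ} (ha : 0 < a) (hl : ∀ i, a < l i) (hdiag : ∀ i, A i i = 0)
    (hlast : ∀ i : Fin d, A i.castSucc (Fin.last d) = t i - l i)
    (hrow : ∀ i : Fin d, A (Fin.last d) i.castSucc = -t i)
    (hA : ∀ i j : Fin d, i ≠ j → A i.castSucc j.castSucc = t i - l i - t j + a) :
    alcoved A = diagProj (fun i => t i - l i + a) ''
      Set.Icc 0 (Fin.snoc (α := fun _ => ℝ) (fun i => l i - a) a) := by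
  ext x
  constructor
  · rintro ⟨h1, h2⟩
    -- `z` is one preimage of `x`. Shifting it diagonally so that its least coordinate `z p` becomes
    -- zero gives the lower bounds; for `i ≠ p` the upper bound on `z i - z p` is the alcove
    -- inequality for the pair `i`, `p`.
    let z : Fin (d + 1) → ℝ := Fin.snoc (α := fun _ => ℝ) (fun i => x i - (t i - l i + a)) 0
    have hz : ∀ i : Fin d, z i.castSucc = x i - (t i - l i + a) := fun i => by simp [z]
    have hz0 : z (Fin.last d) = 0 := by simp [z]
    obtain ⟨p, -, hp⟩ := Finset.exists_min_image Finset.univ z Finset.univ_nonempty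
    refine ⟨fun i => z i - z p, ⟨fun i => sub_nonneg.2 (hp i (Finset.mem_univ i)), fun i => ?_⟩, ?_⟩
    · revert i
      refine Fin.lastCases ?_ fun i => ?_
      · simp only [Fin.snoc_last, hz0]
        refine Fin.lastCases ?_ (fun j => ?_) p
        · rw [hz0]
          linarith
        · rw [hz]
          linarith [(h1 j).1, hlast j]
      · simp only [Fin.snoc_castSucc, hz]
        refine Fin.lastCases ?_ (fun j => ?_) p
        · rw [hz0]
          linarith [(h1 i).2, hrow i]
        · rw [hz]
          rcases eq_or_ne j i with rfl | hij
          · linarith [hl j]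
          · linarith [(h2 j i).1, hA j i hij]
    · funext i
      simp only [diagProj, hz, hz0]
      ring
  · rintro ⟨w, ⟨hw0, hw1⟩, rfl⟩
    have h0 : ∀ i, 0 ≤ w i := hw0
    have h1 : ∀ i : Fin d, w i.castSucc ≤ l i - a := fun i => by simpa using hw1 i.castSucc
    have h2 : w (Fin.last d) ≤ a := by simpa using hw1 (Fin.last d)
    refine ⟨fun i => ?_, fun i j => ?_⟩
    · rw [hlast, hrow]
      simp only [diagProj]
      constructor <;> linarith [h0 i.castSucc, h0 (Fin.last d), h1 i]
    · simp only [diagProj]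
      rcases eq_or_ne i j with rfl | hij
      · simp [hdiag]
      · rw [hA i j hij, hA j i hij.symm]
        constructor <;> linarith [h0 i.castSucc, h0 j.castSucc, h1 i, h1 j]

theorem IsIAP.eq_diagProj {d : ℕ} {P : Set (Fin d → ℝ)} (hP : IsIAP P) :
    ∃ (b : Fin d → ℝ) (m : Fin (d + 1) → ℝ), (∀ i, 0 < m i) ∧
      P = diagProj b '' Set.Icc 0 m := by
  obtain ⟨A, B, E, l, a, rfl, hNI, rfl, -, ⟨-, t, ht0, hB⟩, ⟨-, hErow, hEcol, -⟩, ha, hl, hE⟩ := hP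
  refine ⟨_, _, ?_, alcoved_eq_diagProj (t := fun i => t i.castSucc) ha hl hNI.1
    (fun i => ?_) (fun i => ?_) fun i j hij => ?_⟩
  · refine Fin.lastCases ?_ fun i => ?_
    · simpa using ha
    · simpa using hl i
  · simp [hB, hEcol, ht0, boxVNI, Fin.castSucc_ne_last, sub_eq_add_neg]
  · simp [hB, hErow, ht0, boxVNI]
  · simp [hB, hE i j hij, boxVNI, hij]
    ring

theorem IsIAP.isPolytope {d : ℕ} {P : Set (Fin d → ℝ)} (hP : IsIAP P) : IsPolytope P := by
  obtain ⟨A, -, -, -, -, rfl, -⟩ := hP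
  exact isPolytope_alcoved A

theorem corollary3p15 (d : ℕ) (hd : 2 ≤ d) (P : Set (Fin d → ℝ)) (hP : IsIAP P) :
    IsElementary d P := by
  refine ⟨hP.isPolytope, fun n Q V hQ hV => ?_⟩
  obtain ⟨b, m, hm, rfl⟩ := hP.eq_diagProj
  obtain ⟨F, hF⟩ := hQ.exists_labelling
  obtain ⟨e₁⟩ := nonempty_boundaryComplex_diagProj_orderIso b hm
  obtain ⟨e₂⟩ := hF.nonempty_outerComplex_orderIso (by omega) hV
  exact ⟨e₁.trans e₂.symm⟩
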